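/- Let \(\alpha\in\mathbb{C}\), let \(U\subseteq\mathbb{C}\) be a connected open set, and let \(w\) be a meromorphic solution on \(U\) of the equation P\(_{\rm XXXIV}[\alpha]\), \[2w\,w''-(w')^2+4w^3-8zw^2+16\alpha^2=0 .\] Let \(\psi_0\not\equiv0\) be a meromorphic function on \(U\) with \(2w\psi_0'-w'\psi_0-4\alpha\psi_0=0\); in the degenerate case \(w\equiv0\) (where this equation is void) assume instead that \(\psi_0''+(w-2z)\psi_0=0\). Define \(\varphi_0=\dfrac{w}{2\psi_0}\) and, for \(n>0\), \[\psi_n=\psi_{n-1}'+\frac{w}{2\psi_0}\sum_{k=0}^{n-2}\psi_k\psi_{n-2-k},\qquad \varphi_n=\varphi_{n-1}'+\psi_0\sum_{k=0}^{n-2}\varphi_k\varphi_{n-2-k},\] and, for \(N\in\mathbb{Z}\), let \(\tau_N=\det(\psi_{i+j-2})_{i,j=1,\dots,N}\) if \(N>0\), \(\tau_0=1\), and \(\tau_N=\det(\varphi_{i+j-2})_{i,j=1,\dots,-N}\) if \(N<0\). Let \(D_z^n\,g\cdot f=\left.\left(\frac{d}{dz}-\frac{d}{dz'}\right)^n g(z)f(z')\right|_{z'=z}\)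 be Hirota's bilinear operator. Then for every \(N\in\mathbb{Z}\) the following hold at every point of \(U\) where \(w\) and \(\psi_0\) are holomorphic and \(\psi_0\neq0\) (and hence as identities of meromorphic functions on \(U\)): \[(D_z^2+w-2z)\,\tau_{N+1}\cdot\tau_N=0,\] \[\left[D_z^3+(3w-2z)D_z-4\left(\alpha+N+\tfrac12\right)\right]\tau_{N+1}\cdot\tau_N=0 .\] -/

import Mathlib

noncomputable section

namespace PXXXIV

/-- `w` is a meromorphic solution on `U` of the Painlevé XXXIV equation with parameter `α`,
`2 w w'' - (w')² + 4 w³ - 8 z w² + 16 α² = 0`.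
The equation is required at every point where `w` is analytic. -/
structure IsSolution (α : ℂ) (U : Set ℂ) (w : ℂ → ℂ) : Prop where
  meromorphic : MeromorphicOn w U
  equation : ∀ z ∈ U, AnalyticAt ℂ w z →
    2 * w z * deriv (deriv w) z - (deriv w z) ^ 2 + 4 * w z ^ 3 - 8 * z * w z ^ 2
      + 16 * α ^ 2 = 0

/-- `ψ` is a meromorphic solution on `U` of the first order linear equation
`2 w ψ' - w' ψ - 4 α ψ = 0`. -/
structure IsLinSolution (α : ℂ) (U : Set ℂ) (w ψ : ℂ → ℂ) : Prop where
  meromorphic : MeromorphicOn ψ U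
  equation : ∀ z ∈ U, AnalyticAt ℂ w z → AnalyticAt ℂ ψ z →
    2 * w z * deriv ψ z - deriv w z * ψ z - 4 * α * ψ z = 0

/-- `w` vanishes identically on `U` as a meromorphic function. -/
def VanishesOn (U : Set ℂ) (w : ℂ → ℂ) : Prop :=
  ∀ z ∈ U, AnalyticAt ℂ w z → w z = 0

/-- The second order linear equation `ψ'' + (w - 2 z) ψ = 0` on `U`. -/
def SatisfiesSecondLin (U : Set ℂ) (w ψ : ℂ → ℂ) : Prop :=
  ∀ z ∈ U, AnalyticAt ℂ w z → AnalyticAt ℂ ψ z →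
    deriv (deriv ψ) z + (w z - 2 * z) * ψ z = 0

/-- The sequence `f₀ = f`, `fₙ = fₙ₋₁' + c ∑_{k=0}^{n-2} fₖ fₙ₋₂₋ₖ` for `n > 0`
(the sum being empty for `n = 1`). -/
def recSeq (c f : ℂ → ℂ) : ℕ → ℂ → ℂ
  | 0 => f
  | 1 => deriv f
  | n + 2 => fun z =>
      deriv (recSeq c f (n + 1)) z
        + c z * ∑ k : Fin (n + 1), recSeq c f k z * recSeq c f (n - k) z
  termination_by n => n
  decreasing_by all_goals omega

theorem recSeq_zero (c f : ℂ → ℂ) : recSeq c f 0 = f := by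
  rw [recSeq]

theorem recSeq_one (c f : ℂ → ℂ) : recSeq c f 1 = deriv f := by
  rw [recSeq]

theorem recSeq_add_two (c f : ℂ → ℂ) (n : ℕ) (z : ℂ) :
    recSeq c f (n + 2) z = deriv (recSeq c f (n + 1)) z
      + c z * ∑ k ∈ Finset.range (n + 1), recSeq c f k z * recSeq c f (n - k) z := by
  rw [recSeq, Finset.sum_range]

/-- `φ₀ = w / (2 ψ₀)`. -/
def phi0 (w ψ₀ : ℂ → ℂ) : ℂ → ℂ := fun z => w z / (2 * ψ₀ z)

/-- `ψₙ = ψₙ₋₁' + (w / (2 ψ₀)) ∑_{k=0}^{n-2} ψₖ ψₙ₋₂₋ₖ`, starting from `ψ₀`. -/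
def psi (w ψ₀ : ℂ → ℂ) : ℕ → ℂ → ℂ := recSeq (phi0 w ψ₀) ψ₀

/-- `φₙ = φₙ₋₁' + ψ₀ ∑_{k=0}^{n-2} φₖ φₙ₋₂₋ₖ`, starting from `φ₀ = w / (2 ψ₀)`. -/
def phi (w ψ₀ : ℂ → ℂ) : ℕ → ℂ → ℂ := recSeq ψ₀ (phi0 w ψ₀)

/-- The `n × n` Hankel determinant `det (f_{i+j})_{0 ≤ i, j < n}`; it is `1` for `n = 0`. -/
def hankel (f : ℕ → ℂ → ℂ) (n : ℕ) : ℂ → ℂ := fun z =>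
  (Matrix.of fun i j : Fin n => f ((i : ℕ) + (j : ℕ)) z).det

/-- `τ_N` for `N ∈ ℤ`: the `N × N` Hankel determinant of `(ψₙ)` for `N > 0`, `1` for `N = 0`,
and the `(-N) × (-N)` Hankel determinant of `(φₙ)` for `N < 0`. -/
def tau (w ψ₀ : ℂ → ℂ) (N : ℤ) : ℂ → ℂ :=
  if 0 < N then hankel (psi w ψ₀) N.toNat
  else if N = 0 then fun _ => 1
  else hankel (phi w ψ₀) (-N).toNat

/-- The operator `∂/∂z - ∂/∂z'` on functions of two variables `(z, z')`. -/
def diffOp (F : ℂ → ℂ → ℂ) : ℂ → ℂ → ℂ := fun z z' =>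
  deriv (fun s => F s z') z - deriv (fun s => F z s) z'

/-- Hirota's bilinear operator
`D_zⁿ g · f = (∂/∂z - ∂/∂z')ⁿ g(z) f(z') |_{z' = z}`. -/
def hirotaD (n : ℕ) (g f : ℂ → ℂ) : ℂ → ℂ := fun z =>
  diffOp^[n] (fun s t => g s * f t) z z

end PXXXIV

end

/-! Put f = ψ₀, c = φ₀ = w/(2ψ₀), u = cf. The hypotheses make f and c solutions of the same linear
equation y'' = (2z - 2u)y with Wronskian f'c - fc' = 2α, and w = 2u. The recursion makes each
derivative of a Hankel minor a sum of minors with shifted indices (`IsMomentSeq.derivation_minor`).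
With the Desnanot–Jacobi identity this gives the Toda equation τₙτₙ'' - τₙ'² = τₙ₊₁τₙ₋₁ - uτₙ²
(`IsMomentSeq.toda`). The chain starts with τ₋₁ = c, τ₀ = 1, τ₁ = f. The Wronskian relation
τₙ₊₁'τₙ₋₁ - τₙ₊₁τₙ₋₁' = 2(α + n)τₙ² and the second order bilinear equation propagate together along
it, and the third order equation follows from them (`hankelDet_bilinear`). The induction divides by
τₙ, which may vanish identically for special α. It is therefore run in the polynomial ring in z, f,
f', c, c', where α becomes the nonconstant polynomial (f'c - fc')/2 and no τₙ is zero. Evaluation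
along the given solution transfers the identities. Negative N follows from exchanging f and c, which
replaces α by -α. -/

namespace PXXXIV

open Matrix Filter Topology

/-! ### Derivations and determinants -/

section Det

variable {S R : Type*} [CommRing S] [CommRing R] [Algebra S R] (D : Derivation S R R)

theorem derivation_prod {ι : Type*} [DecidableEq ι] (s : Finset ι) (f : ι → R) :
    D (∏ i ∈ s, f i) = ∑ i ∈ s, D (f i) * ∏ j ∈ s.erase i, f j := by
  induction s using Finset.induction_on with
  | empty => simp
  | insert a s ha ih =>
    rw [Finset.prod_insert ha, D.leibniz, ih, Finset.sum_insert ha, Finset.erase_insert ha,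
      smul_eq_mul, smul_eq_mul, Finset.mul_sum, add_comm, mul_comm]
    congr 1
    refine Finset.sum_congr rfl fun i hi => ?_
    have hia : a ≠ i := fun h => ha (h ▸ hi)
    rw [Finset.erase_insert_of_ne hia, Finset.prod_insert (by simp [ha])]
    ring

variable {m : Type*} [Fintype m] [DecidableEq m]

theorem derivation_det (M : Matrix m m R) :
    D M.det = ∑ j, (M.updateCol j fun i => D (M i j)).det := by
  have h (ε : ℤ) (r : R) : D (ε * r) = ε * D r := by simp
  simp only [det_apply', map_sum, h, derivation_prod]
  rw [Finset.sum_comm]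
  refine Finset.sum_congr rfl fun σ _ => ?_
  rw [← Finset.mul_sum]
  congr 1
  refine Finset.sum_congr rfl fun j _ => ?_
  rw [← Finset.mul_prod_erase _ _ (Finset.mem_univ j)]
  congr 1
  · simp
  · refine Finset.prod_congr rfl fun k hk => ?_
    rw [updateCol_ne (Finset.ne_of_mem_erase hk)]

/-- Expanding along the replaced line, both sides are the trace of `adjugate M * B`. -/
theorem sum_det_updateCol_eq_sum_det_updateRow (M B : Matrix m m R) :
    ∑ j, (M.updateCol j fun i => B i j).det = ∑ i, (M.updateRow i (B i)).det := by
  simp only [← cramer_apply, ← cramer_transpose_apply, cramer_eq_adjugate_mulVec, mulVec,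
    dotProduct, ← adjugate_transpose, transpose_apply]
  exact Finset.sum_comm

end Det

/-! ### Minors of an infinite Hankel matrix -/

section Minor

variable {R : Type*} [CommRing R] {n : ℕ}

/-- The minor of the infinite Hankel matrix `(s (a + b))` with rows `σ` and columns `ρ`. -/
def minor (s : ℕ → R) (σ ρ : Fin n → ℕ) : R :=
  (Matrix.of fun i j => s (σ i + ρ j)).det

theorem minor_comm (s : ℕ → R) (σ ρ : Fin n → ℕ) : minor s σ ρ = minor s ρ σ := by
  rw [minor, ← det_transpose]
  congr 1
  ext i j
  simp [add_comm]

theorem minor_eq_zero_of_row_eq (s : ℕ → R) {σ : Fin n → ℕ} (ρ : Fin n → ℕ) {i j : Fin n}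
    (hij : i ≠ j) (h : σ i = σ j) : minor s σ ρ = 0 :=
  det_zero_of_row_eq hij (by ext k; simp [h])

theorem minor_eq_zero_of_col_eq (s : ℕ → R) (σ : Fin n → ℕ) {ρ : Fin n → ℕ} {i j : Fin n}
    (hij : i ≠ j) (h : ρ i = ρ j) : minor s σ ρ = 0 := by
  rw [minor_comm]
  exact minor_eq_zero_of_row_eq s σ hij h

theorem det_updateCol_hankel (s : ℕ → R) (σ ρ : Fin n → ℕ) (j : Fin n) (b : ℕ) :
    ((Matrix.of fun i j => s (σ i + ρ j)).updateCol j fun i => s (σ i + b)).det =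
      minor s σ (Function.update ρ j b) := by
  rw [minor]
  congr 1
  ext i k
  rcases eq_or_ne k j with rfl | h
  · simp
  · simp [h]

theorem det_updateRow_hankel (s : ℕ → R) (σ ρ : Fin n → ℕ) (i : Fin n) (a : ℕ) :
    ((Matrix.of fun i j => s (σ i + ρ j)).updateRow i fun j => s (a + ρ j)).det =
      minor s (Function.update σ i a) ρ := by
  rw [minor]
  congr 1
  ext k j
  rcases eq_or_ne k i with rfl | h
  · simp
  · simp [h]

/-- The sequence `s` satisfies `s (n + 1) = D (s n) + c ∑ s k s (n - 1 - k)`. -/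
def IsMomentSeq {S : Type*} [CommRing S] [Algebra S R] (D : Derivation S R R) (c : R)
    (s : ℕ → R) : Prop :=
  ∀ n, D (s n) = s (n + 1) - c * ∑ k ∈ Finset.range n, s k * s (n - 1 - k)

variable {S : Type*} [CommRing S] [Algebra S R] {D : Derivation S R R} {c : R} {s : ℕ → R}

/-- Cutting the convolution at index a leaves one part that combines columns with coefficients
independent of the row index a, and one that combines rows with coefficients independent of b. -/
theorem IsMomentSeq.derivation_add (hs : IsMomentSeq D c s) (a b : ℕ) :
    D (s (a + b)) = (s (a + (b + 1)) - c * ∑ k ∈ Finset.range b, s k * s (a + (b - 1 - k)))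
      - c * ∑ k ∈ Finset.range a, s k * s (a - 1 - k + b) := by
  have h : ∑ k ∈ Finset.range (a + b), s k * s (a + b - 1 - k)
      = ∑ k ∈ Finset.range b, s k * s (a + (b - 1 - k))
        + ∑ k ∈ Finset.range a, s k * s (a - 1 - k + b) := by
    rw [Finset.sum_range_add, add_comm]
    congr 1
    · rw [← Finset.sum_range_reflect]
      refine Finset.sum_congr rfl fun k hk => ?_
      have := Finset.mem_range.1 hk
      rw [mul_comm]
      congr 2
      all_goals omega
    · refine Finset.sum_congr rfl fun k hk => ?_
      have := Finset.mem_range.1 hk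
      congr 2; omega
  rw [hs, h]
  ring_nf

theorem det_updateCol_sub_mul_sum (M : Matrix (Fin n) (Fin n) R) (j : Fin n) (u : Fin n → R)
    (c : R) (t : Finset ℕ) (r : ℕ → R) (v : ℕ → Fin n → R) :
    (M.updateCol j fun i => u i - c * ∑ k ∈ t, r k * v k i).det =
      (M.updateCol j u).det - c * ∑ k ∈ t, r k * (M.updateCol j (v k)).det := by
  simp only [← cramer_apply]
  have : (fun i => u i - c * ∑ k ∈ t, r k * v k i) = u - c • ∑ k ∈ t, r k • v k := by
    ext i
    simp
  rw [this]
  simp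

theorem det_updateRow_mul_sum (M : Matrix (Fin n) (Fin n) R) (i : Fin n)
    (c : R) (t : Finset ℕ) (r : ℕ → R) (v : ℕ → Fin n → R) :
    (M.updateRow i fun j => c * ∑ k ∈ t, r k * v k j).det =
      c * ∑ k ∈ t, r k * (M.updateRow i (v k)).det := by
  simp only [← cramer_transpose_apply]
  have : (fun i => c * ∑ k ∈ t, r k * v k i) = c • ∑ k ∈ t, r k • v k := by
    ext i
    simp
  rw [this]
  simp

theorem IsMomentSeq.derivation_minor (hs : IsMomentSeq D c s) (σ ρ : Fin n → ℕ) :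
    D (minor s σ ρ) = ∑ j, minor s σ (Function.update ρ j (ρ j + 1))
      - c * ∑ j, ∑ k ∈ Finset.range (ρ j), s k * minor s σ (Function.update ρ j (ρ j - 1 - k))
      - c * ∑ i, ∑ k ∈ Finset.range (σ i),
          s k * minor s (Function.update σ i (σ i - 1 - k)) ρ := by
  rw [minor, derivation_det]
  simp only [of_apply, hs.derivation_add]
  have hsub : ∀ j : Fin n, ((Matrix.of fun i j => s (σ i + ρ j)).updateCol j fun i =>
        (s (σ i + (ρ j + 1)) - c * ∑ k ∈ Finset.range (ρ j), s k * s (σ i + (ρ j - 1 - k)))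
          - c * ∑ k ∈ Finset.range (σ i), s k * s (σ i - 1 - k + ρ j)).det =
      ((Matrix.of fun i j => s (σ i + ρ j)).updateCol j fun i =>
        (s (σ i + (ρ j + 1)) - c * ∑ k ∈ Finset.range (ρ j), s k * s (σ i + (ρ j - 1 - k)))).det -
      ((Matrix.of fun i j => s (σ i + ρ j)).updateCol j fun i =>
        (Matrix.of fun i j => c * ∑ k ∈ Finset.range (σ i), s k * s (σ i - 1 - k + ρ j)) i j).det
      := by
    intro j
    simp only [← cramer_apply]
    rw [← Pi.sub_apply, ← map_sub]
    rfl
  -- The row part is not a combination of columns, so its sum over replaced columns is turned into a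
  -- sum over replaced rows.
  rw [Finset.sum_congr rfl fun j _ => hsub j, Finset.sum_sub_distrib,
    sum_det_updateCol_eq_sum_det_updateRow]
  congr 1
  · rw [Finset.mul_sum, ← Finset.sum_sub_distrib]
    refine Finset.sum_congr rfl fun j _ => ?_
    have h := det_updateCol_sub_mul_sum (Matrix.of fun i j => s (σ i + ρ j)) j
      (fun i => s (σ i + (ρ j + 1))) c (Finset.range (ρ j)) s
      (fun k i => s (σ i + (ρ j - 1 - k)))
    simp only [det_updateCol_hankel] at h
    exact h
  · rw [Finset.mul_sum]
    refine Finset.sum_congr rfl fun i _ => ?_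
    have h := det_updateRow_mul_sum (Matrix.of fun i j => s (σ i + ρ j)) i c
      (Finset.range (σ i)) s (fun k j => s (σ i - 1 - k + ρ j))
    simp only [det_updateRow_hankel] at h
    exact h

end Minor

/-! ### The Toda equation for Hankel determinants -/

section Toda

variable {R : Type*} [CommRing R]

/-- The Hankel determinant `det (s (i + j))` of size `n`. -/
def hankelDet (s : ℕ → R) (n : ℕ) : R := minor s (fun i : Fin n => (i : ℕ)) fun i => (i : ℕ)

/-- The indices `0, …, n - 1, n + 1`. -/
def skipIndex (n : ℕ) : Fin (n + 1) → ℕ :=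
  Function.update (fun i => (i : ℕ)) (Fin.last n) (n + 1)

theorem skipIndex_last (n : ℕ) : skipIndex n (Fin.last n) = n + 1 := by simp [skipIndex]

theorem skipIndex_of_ne {n : ℕ} {i : Fin (n + 1)} (h : i ≠ Fin.last n) : skipIndex n i = i := by
  simp [skipIndex, h]

variable {S : Type*} [CommRing S] [Algebra S R] {D : Derivation S R R} {c : R} {s : ℕ → R}

theorem minor_update_val_eq_zero (s : ℕ → R) {n : ℕ} (σ : Fin n → ℕ) (j : Fin n) {b : ℕ}
    (hb : b < n) (hj : b ≠ j) :
    minor s σ (Function.update (fun i : Fin n => (i : ℕ)) j b) = 0 := by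
  have hne : j ≠ ⟨b, hb⟩ := fun h => hj (by rw [h])
  exact minor_eq_zero_of_col_eq s σ hne (by simp [Function.update_of_ne hne.symm])

theorem minor_update_skipIndex_eq_zero (s : ℕ → R) {n : ℕ} (ρ : Fin (n + 1) → ℕ)
    (j : Fin (n + 1)) {b : ℕ} (hb : b < n) (hj : b ≠ j) :
    minor s (Function.update (skipIndex n) j b) ρ = 0 := by
  have hne : j ≠ ⟨b, by omega⟩ := fun h => hj (by rw [h])
  refine minor_eq_zero_of_row_eq s ρ hne ?_
  rw [Function.update_self, Function.update_of_ne hne.symm, skipIndex_of_ne]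
  exact fun h => by simp [Fin.ext_iff] at h; omega

/-- With columns 0, …, n, any shift of one column repeats another, except raising the last. -/
theorem IsMomentSeq.derivation_minor_val (hs : IsMomentSeq D c s) {n : ℕ}
    (σ : Fin (n + 1) → ℕ) :
    D (minor s σ fun i => (i : ℕ)) = minor s σ (skipIndex n)
      - c * ∑ i, ∑ k ∈ Finset.range (σ i),
          s k * minor s (Function.update σ i (σ i - 1 - k)) fun i => (i : ℕ) := by
  rw [hs.derivation_minor]
  congr 1
  have h1 : ∑ j : Fin (n + 1), ∑ k ∈ Finset.range (j : ℕ),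
      s k * minor s σ (Function.update (fun i => (i : ℕ)) j (j - 1 - k)) = 0 := by
    refine Finset.sum_eq_zero fun j _ => Finset.sum_eq_zero fun k hk => ?_
    have := Finset.mem_range.1 hk
    rw [minor_update_val_eq_zero _ _ _ (by omega) (by omega), mul_zero]
  rw [h1, mul_zero, sub_zero, Finset.sum_eq_single (Fin.last n)]
  · rfl
  · intro j _ hj
    have : (j : ℕ) < n := Fin.lt_last_iff_ne_last.2 hj
    exact minor_update_val_eq_zero _ _ _ (by omega) (by omega)
  · simp

theorem IsMomentSeq.derivation_hankelDet (hs : IsMomentSeq D c s) (n : ℕ) :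
    D (hankelDet s (n + 1)) = minor s (skipIndex n) fun i => (i : ℕ) := by
  rw [hankelDet, hs.derivation_minor_val, minor_comm, Finset.sum_eq_zero, mul_zero, sub_zero]
  refine fun j _ => Finset.sum_eq_zero fun k hk => ?_
  have := Finset.mem_range.1 hk
  rw [minor_comm, minor_update_val_eq_zero _ _ _ (by omega) (by omega), mul_zero]

theorem IsMomentSeq.derivation_derivation_hankelDet (hs : IsMomentSeq D c s) (n : ℕ) :
    D (D (hankelDet s (n + 1))) =
      minor s (skipIndex n) (skipIndex n) - c * s 0 * hankelDet s (n + 1) := by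
  -- Only lowering the last row from n + 1 to n (k = 0) avoids a repeated row, and it restores the
  -- full Hankel determinant.
  rw [hs.derivation_hankelDet, hs.derivation_minor_val, Finset.sum_eq_single (Fin.last n),
    Finset.sum_eq_single 0, mul_assoc, skipIndex_last]
  · congr 4
    ext i
    rcases eq_or_ne i (Fin.last n) with rfl | h
    · simp
    · simp [h, skipIndex]
  · intro k hk hk0
    rw [skipIndex_last] at hk ⊢
    have := Finset.mem_range.1 hk
    rw [minor_update_skipIndex_eq_zero _ _ _ (by omega) (by simp; omega), mul_zero]
  · simp [skipIndex_last]
  · intro j _ hj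
    refine Finset.sum_eq_zero fun k hk => ?_
    rw [skipIndex_of_ne hj] at hk ⊢
    have := Finset.mem_range.1 hk
    have : (j : ℕ) < n := Fin.lt_last_iff_ne_last.2 hj
    rw [minor_update_skipIndex_eq_zero _ _ _ (by omega) (by omega), mul_zero]
  · simp

/-- The Desnanot–Jacobi identity for a matrix with an invertible leading block. -/
theorem det_fromBlocks_mul_det_eq {K : Type*} [Field K] {n : ℕ} (A : Matrix (Fin n) (Fin n) K)
    (B : Matrix (Fin n) (Fin 2) K) (C : Matrix (Fin 2) (Fin n) K) (E : Matrix (Fin 2) (Fin 2) K)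
    (hA : A.det ≠ 0) (q : Fin 2 → Fin 2 → K)
    (hq : ∀ k l, q k l = (fromBlocks A (B.submatrix id fun _ : Fin 1 => l)
      (C.submatrix (fun _ : Fin 1 => k) id) (E.submatrix (fun _ => k) fun _ => l)).det) :
    (fromBlocks A B C E).det * A.det = q 0 0 * q 1 1 - q 0 1 * q 1 0 := by
  have : Invertible A := A.invertibleOfIsUnitDet (isUnit_iff_ne_zero.2 hA)
  have h : ∀ k l, q k l = A.det * (E - C * ⅟A * B) k l := by
    intro k l
    rw [hq, det_fromBlocks₁₁, det_fin_one]
    simp [Matrix.mul_apply]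
  rw [h, h, h, h, det_fromBlocks₁₁, det_fin_two]
  ring

theorem minor_eq_det_fromBlocks (s : ℕ → R) {n m : ℕ} (σ ρ : Fin (n + m) → ℕ) :
    minor s σ ρ = (fromBlocks
      (Matrix.of fun i j : Fin n => s (σ (Fin.castAdd m i) + ρ (Fin.castAdd m j)))
      (Matrix.of fun (i : Fin n) (j : Fin m) => s (σ (Fin.castAdd m i) + ρ (Fin.natAdd n j)))
      (Matrix.of fun (i : Fin m) (j : Fin n) => s (σ (Fin.natAdd n i) + ρ (Fin.castAdd m j)))
      (Matrix.of fun i j : Fin m => s (σ (Fin.natAdd n i) + ρ (Fin.natAdd n j)))).det := by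
  rw [minor, ← det_submatrix_equiv_self finSumFinEquiv]
  congr 1
  ext (i | i) (j | j) <;> simp

theorem hankelDet_jacobi_of_field {K : Type*} [Field K] (s : ℕ → K) (n : ℕ)
    (h : hankelDet s n ≠ 0) :
    hankelDet s (n + 2) * hankelDet s n =
      hankelDet s (n + 1) * minor s (skipIndex n) (skipIndex n)
        - (minor s (skipIndex n) fun i => (i : ℕ)) ^ 2 := by
  let p : Fin 2 → Fin (n + 1) → ℕ := ![fun i => (i : ℕ), skipIndex n]
  have hp1 : ∀ k i, p k (Fin.castAdd 1 i) = i := by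
    intro k i
    fin_cases k
    · rfl
    · exact skipIndex_of_ne (Fin.castSucc_lt_last i).ne
  have hp2 : ∀ k i, p k (Fin.natAdd n i) = n + k := by
    intro k i
    obtain rfl : i = 0 := Subsingleton.elim _ _
    fin_cases k
    · rfl
    · exact skipIndex_last n
  have := det_fromBlocks_mul_det_eq (Matrix.of fun i j : Fin n => s (i + j))
    (Matrix.of fun (i : Fin n) (j : Fin 2) => s (i + (n + j)))
    (Matrix.of fun (i : Fin 2) (j : Fin n) => s (n + i + j))
    (Matrix.of fun i j : Fin 2 => s (n + i + (n + j))) h (fun k l => minor s (p k) (p l))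
    (fun k l => by
      rw [minor_eq_det_fromBlocks]
      simp only [hp1, hp2]
      rfl)
  rw [hankelDet, minor_eq_det_fromBlocks]
  refine this.trans ?_
  rw [minor_comm s (p 0) (p 1), ← sq]
  rfl

theorem map_minor {R' : Type*} [CommRing R'] (f : R →+* R') (s : ℕ → R) {n : ℕ}
    (σ ρ : Fin n → ℕ) : f (minor s σ ρ) = minor (fun k => f (s k)) σ ρ := by
  rw [minor, f.map_det]
  rfl

theorem hankelDet_jacobi [IsDomain R] (s : ℕ → R) (n : ℕ) (h : hankelDet s n ≠ 0) :
    hankelDet s (n + 2) * hankelDet s n =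
      hankelDet s (n + 1) * minor s (skipIndex n) (skipIndex n)
        - (minor s (skipIndex n) fun i => (i : ℕ)) ^ 2 := by
  have hinj := IsFractionRing.injective R (FractionRing R)
  have := hankelDet_jacobi_of_field (fun k => algebraMap R (FractionRing R) (s k)) n
    (by rw [hankelDet, ← map_minor]; exact (map_ne_zero_iff _ hinj).2 h)
  simp only [hankelDet, ← map_minor, ← map_mul, ← map_pow, ← map_sub] at this
  exact hinj this

theorem IsMomentSeq.toda [IsDomain R] (hs : IsMomentSeq D c s) (n : ℕ) (h : hankelDet s n ≠ 0) :
    hankelDet s (n + 1) * D (D (hankelDet s (n + 1))) - D (hankelDet s (n + 1)) ^ 2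
      - hankelDet s (n + 2) * hankelDet s n + c * s 0 * hankelDet s (n + 1) ^ 2 = 0 := by
  rw [hankelDet_jacobi s n h, hs.derivation_derivation_hankelDet, hs.derivation_hankelDet]
  ring

end Toda

/-! ### Propagation of the bilinear equations along the Toda chain -/

section Chain

variable {R : Type*} [CommRing R] [IsDomain R] [Algebra ℂ R] {D : Derivation ℂ R R}

theorem toda_wronskian_step {a b c d u x A : R} (hb : b ≠ 0) (hx : D x = 1)
    (hW : D c * a - c * D a - 2 * A * b ^ 2 = 0)
    (hT : b * D (D b) - D b ^ 2 - c * a + u * b ^ 2 = 0)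
    (hT' : c * D (D c) - D c ^ 2 - d * b + u * c ^ 2 = 0)
    (hE : D (D c) * b - 2 * D c * D b + c * D (D b) + (2 * u - 2 * x) * (c * b) = 0) :
    D d * b - d * D b - 2 * (A + 1) * c ^ 2 = 0 := by
  have h2 : D 2 = 0 := by exact_mod_cast D.map_natCast 2
  have hdT := congrArg D hT
  have hdT' := congrArg D hT'
  have hdE := congrArg D hE
  simp only [map_add, map_sub, D.leibniz, D.leibniz_pow, smul_eq_mul, map_zero, hx, h2,
    nsmul_eq_mul, Nat.cast_ofNat, Nat.add_one_sub_one, pow_one] at hdT hdT' hdE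
  refine (mul_eq_zero.1 (?_ : b ^ 2 * _ = 0)).resolve_left (pow_ne_zero 2 hb)
  linear_combination b * (-b * hdT' + 2 * D b * hT' + c * hdE - D c * hE) - D b * c * hE
    + 2 * D c * c * hT - c ^ 2 * hdT + c ^ 2 * hW

theorem toda_second_order_step {b c d u x A : R} (hb : b ≠ 0) (hA : D A = 0)
    (hE : D (D c) * b - 2 * D c * D b + c * D (D b) + (2 * u - 2 * x) * (c * b) = 0)
    (hW' : D d * b - d * D b - 2 * (A + 1) * c ^ 2 = 0) :
    D (D d) * c - 2 * D d * D c + d * D (D c) + (2 * u - 2 * x) * (d * c) = 0 := by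
  have h2 : D 2 = 0 := by exact_mod_cast D.map_natCast 2
  have hdW := congrArg D hW'
  simp only [map_add, map_sub, D.leibniz, D.leibniz_pow, smul_eq_mul, map_zero, hA, h2,
    nsmul_eq_mul, Nat.cast_ofNat, Nat.add_one_sub_one, pow_one, D.map_one_eq_zero] at hdW
  refine (mul_eq_zero.1 (?_ : b * _ = 0)).resolve_left hb
  linear_combination c * hdW - 2 * D c * hW' + d * hE

/-- In the notation of `toda_wronskian_step`, this is p'' = Q' - P' = 4A + 2 - 2p(P + Q), combined
with P + Q + p² = 2x. -/
theorem toda_third_order {a b c u x A : R} (hb : b ≠ 0) (hx : D x = 1)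
    (hW : D c * a - c * D a - 2 * A * b ^ 2 = 0)
    (hT : b * D (D b) - D b ^ 2 - c * a + u * b ^ 2 = 0)
    (hE : D (D c) * b - 2 * D c * D b + c * D (D b) + (2 * u - 2 * x) * (c * b) = 0) :
    D (D (D c)) * b - 3 * D (D c) * D b + 3 * D c * D (D b) - c * D (D (D b))
      + (6 * u - 2 * x) * (D c * b - c * D b) - (4 * A + 2) * (c * b) = 0 := by
  have h2 : D 2 = 0 := by exact_mod_cast D.map_natCast 2
  have hdT := congrArg D hT
  have hdE := congrArg D hE
  simp only [map_add, map_sub, D.leibniz, D.leibniz_pow, smul_eq_mul, map_zero, hx, h2,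
    nsmul_eq_mul, Nat.cast_ofNat, Nat.add_one_sub_one, pow_one] at hdT hdE
  refine (mul_eq_zero.1 (?_ : b * _ = 0)).resolve_left hb
  linear_combination b * hdE + 2 * (-D b * hE + 2 * D c * hT - c * hdT + c * hW)

/-- The pair of bilinear equations for consecutive Hankel determinants, in a differential domain
where the Wronskian parameter `A` avoids the non-positive integers. -/
theorem hankelDet_bilinear {c f x A : R} {s : ℕ → R} (hs : IsMomentSeq D c s) (hs0 : s 0 = f)
    (hx : D x = 1) (hA : D A = 0) (hAn : ∀ n : ℕ, A + n ≠ 0)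
    (hf : D (D f) = (2 * x - 2 * (c * f)) * f) (hW : D f * c - f * D c = 2 * A) (n : ℕ) :
    let b := hankelDet s n
    let e := hankelDet s (n + 1)
    D (D e) * b - 2 * D e * D b + e * D (D b) + (2 * (c * f) - 2 * x) * (e * b) = 0 ∧
    D (D (D e)) * b - 3 * D (D e) * D b + 3 * D e * D (D b) - e * D (D (D b))
      + (6 * (c * f) - 2 * x) * (D e * b - e * D b) - (4 * (A + n) + 2) * (e * b) = 0 := by
  have hchar : CharZero R := charZero_of_injective_algebraMap (algebraMap ℂ R).injective
  have h0 : hankelDet s 0 = 1 := det_fin_zero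
  have h1 : hankelDet s 1 = f := by simp [hankelDet, minor, hs0]
  suffices h : ∃ a, hankelDet s n ≠ 0 ∧
      D (hankelDet s (n + 1)) * a - hankelDet s (n + 1) * D a
        - 2 * (A + n) * hankelDet s n ^ 2 = 0 ∧
      hankelDet s n * D (D (hankelDet s n)) - D (hankelDet s n) ^ 2 - hankelDet s (n + 1) * a
        + c * f * hankelDet s n ^ 2 = 0 ∧
      D (D (hankelDet s (n + 1))) * hankelDet s n
        - 2 * D (hankelDet s (n + 1)) * D (hankelDet s n)
        + hankelDet s (n + 1) * D (D (hankelDet s n))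
        + (2 * (c * f) - 2 * x) * (hankelDet s (n + 1) * hankelDet s n) = 0 by
    obtain ⟨a, hb, hW, hT, hE⟩ := h
    exact ⟨hE, toda_third_order hb hx hW hT hE⟩
  induction n with
  | zero =>
    -- The predecessor of τ₀ = 1 is τ₋₁ = c.
    refine ⟨c, ?_⟩
    simp only [h0, zero_add, h1, D.map_one_eq_zero, map_zero, hf, Nat.cast_zero]
    refine ⟨one_ne_zero, ?_, ?_, ?_⟩
    · linear_combination hW
    · ring
    · ring
  | succ n ih =>
    obtain ⟨a, hb, hW, hT, hE⟩ := ih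
    have hT' := hs.toda n hb
    rw [hs0] at hT'
    have hW' := toda_wronskian_step hb hx hW hT hT' hE
    have hAn' : D (A + n) = 0 := by simp [hA]
    refine ⟨hankelDet s n, ?_, ?_, hT', toda_second_order_step hb hAn' hE hW'⟩
    -- If τₙ₊₁ were zero, the Wronskian relation would force (A + n)τₙ² = 0.
    · intro hc
      rw [hc] at hW
      have : 2 * (A + n) * hankelDet s n ^ 2 = 0 := by
        simpa using hW
      simp [hAn n, hb] at this
    · push_cast
      linear_combination hW'

end Chain

/-! ### Hirota derivatives -/

section Hirota

theorem diffOp_iterate_swap (n : ℕ) (F : ℂ → ℂ → ℂ) :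
    diffOp^[n] (fun s t => F t s) = fun s t => (-1) ^ n * diffOp^[n] F t s := by
  induction n with
  | zero => simp
  | succ n ih =>
    rw [Function.iterate_succ_apply', ih, Function.iterate_succ_apply']
    funext s t
    simp only [diffOp, deriv_const_mul_field]
    ring

theorem hirotaD_comm (n : ℕ) (g f : ℂ → ℂ) (z : ℂ) :
    hirotaD n f g z = (-1) ^ n * hirotaD n g f z := by
  have := congrFun₂ (diffOp_iterate_swap n fun s t => g s * f t) z z
  simp only [mul_comm (g _)] at this
  simpa only [hirotaD, mul_comm (g _)] using this

theorem diffOp_eq_of_eqOn {V : Set ℂ} (hV : IsOpen V) {F H : ℂ → ℂ → ℂ}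
    (hFH : ∀ s ∈ V, ∀ t ∈ V, F s t = H s t) {s t : ℂ} (hs : s ∈ V) (ht : t ∈ V) {a b : ℂ}
    (ha : HasDerivAt (fun x => H x t) a s) (hb : HasDerivAt (fun x => H s x) b t) :
    diffOp F s t = a - b := by
  rw [diffOp]
  congr 1
  · refine (ha.congr_of_eventuallyEq ?_).deriv
    filter_upwards [hV.mem_nhds hs] with x hx using hFH x hx t ht
  · refine (hb.congr_of_eventuallyEq ?_).deriv
    filter_upwards [hV.mem_nhds ht] with x hx using hFH s hs x hx

theorem hirotaD_formulas {V : Set ℂ} (hV : IsOpen V) {G F : ℂ → ℂ} {g f : ℕ → ℂ → ℂ}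
    (hG : ∀ z ∈ V, G z = g 0 z) (hF : ∀ z ∈ V, F z = f 0 z)
    (hg : ∀ k, ∀ z ∈ V, HasDerivAt (g k) (g (k + 1) z) z)
    (hf : ∀ k, ∀ z ∈ V, HasDerivAt (f k) (f (k + 1) z) z) {z : ℂ} (hz : z ∈ V) :
    hirotaD 1 G F z = g 1 z * f 0 z - g 0 z * f 1 z ∧
    hirotaD 2 G F z = g 2 z * f 0 z - 2 * g 1 z * f 1 z + g 0 z * f 2 z ∧
    hirotaD 3 G F z =
      g 3 z * f 0 z - 3 * g 2 z * f 1 z + 3 * g 1 z * f 2 z - g 0 z * f 3 z := by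
  have h1 : ∀ s ∈ V, ∀ t ∈ V,
      diffOp (fun s t => G s * F t) s t = g 1 s * f 0 t - g 0 s * f 1 t := by
    intro s hs t ht
    exact diffOp_eq_of_eqOn hV (H := fun s t => g 0 s * f 0 t)
      (fun s hs t ht => by rw [hG s hs, hF t ht]) hs ht
      ((hg 0 s hs).mul_const _) ((hf 0 t ht).const_mul _)
  have h2 : ∀ s ∈ V, ∀ t ∈ V, diffOp (diffOp fun s t => G s * F t) s t =
      g 2 s * f 0 t - 2 * g 1 s * f 1 t + g 0 s * f 2 t := by
    intro s hs t ht
    rw [diffOp_eq_of_eqOn hV h1 hs ht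
      (((hg 1 s hs).mul_const _).sub ((hg 0 s hs).mul_const _))
      (((hf 0 t ht).const_mul _).sub ((hf 1 t ht).const_mul _))]
    ring
  refine ⟨h1 z hz z hz, h2 z hz z hz, ?_⟩
  change diffOp (diffOp (diffOp fun s t => G s * F t)) z z = _
  rw [diffOp_eq_of_eqOn hV h2 hz hz
    ((((hg 2 z hz).mul_const _).sub (((hg 1 z hz).const_mul 2).mul_const _)).add
      ((hg 0 z hz).mul_const _))
    ((((hf 0 z hz).const_mul _).sub ((hf 1 z hz).const_mul _)).add ((hf 2 z hz).const_mul _))]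
  ring

end Hirota

/-! ### The generic solution -/

section Jet

open MvPolynomial

/-- The sequence with `s 0 = f` and `s (n + 1) = D (s n) + c ∑ s k s (n - 1 - k)`. -/
def momentSeq {R : Type*} [CommRing R] [Algebra ℂ R] (D : Derivation ℂ R R) (c f : R) : ℕ → R
  | 0 => f
  | n + 1 => D (momentSeq D c f n)
      + c * ∑ k : Fin n, momentSeq D c f k * momentSeq D c f (n - 1 - k)
  termination_by n => n
  decreasing_by all_goals omega

theorem momentSeq_succ {R : Type*} [CommRing R] [Algebra ℂ R] (D : Derivation ℂ R R) (c f : R)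
    (n : ℕ) : momentSeq D c f (n + 1) = D (momentSeq D c f n)
      + c * ∑ k ∈ Finset.range n, momentSeq D c f k * momentSeq D c f (n - 1 - k) := by
  rw [momentSeq, Finset.sum_range]

theorem momentSeq_zero {R : Type*} [CommRing R] [Algebra ℂ R] (D : Derivation ℂ R R) (c f : R) :
    momentSeq D c f 0 = f := by
  rw [momentSeq]

theorem isMomentSeq_momentSeq {R : Type*} [CommRing R] [Algebra ℂ R] (D : Derivation ℂ R R)
    (c f : R) : IsMomentSeq D c (momentSeq D c f) := by
  intro n
  rw [momentSeq_succ]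
  ring

/-- Polynomials in `z, f, f', c, c'`. -/
abbrev JetRing : Type := MvPolynomial (Fin 5) ℂ

/-- The derivation `d/dz` along `f'' = (2 z - 2 c f) f`, `c'' = (2 z - 2 c f) c`. -/
noncomputable def jetDer : Derivation ℂ JetRing JetRing :=
  mkDerivation ℂ ![1, X 2, (2 * X 0 - 2 * (X 3 * X 1)) * X 1, X 4,
    (2 * X 0 - 2 * (X 3 * X 1)) * X 3]

/-- The conserved quantity `(f' c - f c') / 2`. -/
noncomputable def jetAlpha : JetRing := C (1 / 2) * (X 2 * X 3 - X 1 * X 4)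

theorem jetAlpha_spec : (X 2 * X 3 - X 1 * X 4 : JetRing) = 2 * jetAlpha := by
  have : (2 : JetRing) * C (1 / 2) = 1 := by
    rw [show (2 : JetRing) = C 2 from (map_ofNat C 2).symm, ← C_mul]
    norm_num
  rw [jetAlpha, ← mul_assoc, this, one_mul]

theorem jetDer_X (i : Fin 5) : jetDer (X i) = (![1, X 2, (2 * X 0 - 2 * (X 3 * X 1)) * X 1, X 4,
    (2 * X 0 - 2 * (X 3 * X 1)) * X 3] : Fin 5 → JetRing) i :=
  mkDerivation_X ..

theorem jetDer_jetAlpha : jetDer jetAlpha = 0 := by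
  rw [jetAlpha, C_mul', jetDer.map_smul, map_sub, jetDer.leibniz, jetDer.leibniz]
  simp only [jetDer_X, smul_eq_mul, cons_val]
  ring_nf
  simp

theorem jetAlpha_add_natCast_ne_zero (n : ℕ) : jetAlpha + n ≠ 0 := by
  intro h
  -- At this point `jetAlpha` equals 1 - n, so the sum equals 1.
  have := congrArg (eval ![0, 0, 1, 2 * (1 - (n : ℂ)), 0]) h
  simp [jetAlpha] at this

/-- Evaluation of a polynomial in `z, f, f', c, c'`. -/
noncomputable def jetEval (c f : ℂ → ℂ) (z : ℂ) : JetRing →+* ℂ :=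
  eval ![z, f z, deriv f z, c z, deriv c z]

/-- `(f, c)` solves `f'' = (2 z - 2 c f) f`, `c'' = (2 z - 2 c f) c` on `V`. -/
structure IsPair (V : Set ℂ) (c f : ℂ → ℂ) : Prop where
  left : ∀ z ∈ V, HasDerivAt f (deriv f z) z
  left' : ∀ z ∈ V, HasDerivAt (deriv f) ((2 * z - 2 * (c z * f z)) * f z) z
  right : ∀ z ∈ V, HasDerivAt c (deriv c z) z
  right' : ∀ z ∈ V, HasDerivAt (deriv c) ((2 * z - 2 * (c z * f z)) * c z) z

variable {V : Set ℂ} {c f : ℂ → ℂ}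

theorem IsPair.symm (h : IsPair V c f) : IsPair V f c where
  left := h.right
  left' z hz := by simpa only [mul_comm (f z)] using h.right' z hz
  right := h.left
  right' z hz := by simpa only [mul_comm (f z)] using h.left' z hz

theorem IsPair.hasDerivAt_jetEval (h : IsPair V c f) {z : ℂ} (hz : z ∈ V) (r : JetRing) :
    HasDerivAt (fun s => jetEval c f s r) (jetEval c f z (jetDer r)) z := by
  induction r using MvPolynomial.induction_on with
  | C a =>
    rw [show jetDer (C a) = 0 from jetDer.map_algebraMap a, map_zero]
    simpa [jetEval] using hasDerivAt_const z a
  | add p q hp hq =>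
    simp only [map_add]
    exact hp.add hq
  | mul_X p i hp =>
    have hX : HasDerivAt (fun s => jetEval c f s (X i)) (jetEval c f z (jetDer (X i))) z := by
      rw [jetDer_X]
      fin_cases i
      · simpa [jetEval] using hasDerivAt_id' z
      · simpa [jetEval] using h.left z hz
      · simpa [jetEval] using h.left' z hz
      · simpa [jetEval] using h.right z hz
      · simpa [jetEval] using h.right' z hz
    simp only [jetDer.leibniz, smul_eq_mul, map_add, map_mul]
    refine (hp.mul hX).congr_deriv ?_
    ring

theorem IsPair.recSeq_eq (h : IsPair V c f) (hV : IsOpen V) (n : ℕ) :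
    ∀ z ∈ V, recSeq c f n z = jetEval c f z (momentSeq jetDer (X 3) (X 1) n) := by
  induction n using Nat.strong_induction_on with
  | _ n ih =>
    have hd : ∀ m < n, ∀ z ∈ V, deriv (recSeq c f m) z =
        jetEval c f z (jetDer (momentSeq jetDer (X 3) (X 1) m)) := by
      intro m hm z hz
      refine ((h.hasDerivAt_jetEval hz _).congr_of_eventuallyEq ?_).deriv
      filter_upwards [hV.mem_nhds hz] with s hs using ih m hm s hs
    intro z hz
    match n with
    | 0 => simp [recSeq_zero, momentSeq_zero, jetEval]
    | 1 =>
      rw [recSeq_one, momentSeq_succ, Finset.sum_range_zero, mul_zero, add_zero,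
        ← hd 0 one_pos z hz, recSeq_zero]
    | n + 2 =>
      rw [recSeq_add_two, momentSeq_succ, hd (n + 1) (by omega) z hz, map_add, map_mul, map_sum]
      congr 2
      · simp [jetEval]
      · refine Finset.sum_congr rfl fun k hk => ?_
        have := Finset.mem_range.1 hk
        rw [map_mul, ih k (by omega) z hz, ih (n - k) (by omega) z hz]
        rfl

theorem IsPair.hankel_eq (h : IsPair V c f) (hV : IsOpen V) (n : ℕ) {z : ℂ} (hz : z ∈ V) :
    hankel (recSeq c f) n z =
      jetEval c f z (hankelDet (momentSeq jetDer (X 3) (X 1)) n) := by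
  rw [hankelDet, map_minor, hankel, minor]
  simp only [h.recSeq_eq hV _ z hz]

theorem IsPair.hankel_bilinear (h : IsPair V c f) (hV : IsOpen V) {α z : ℂ} (hz : z ∈ V)
    (hW : deriv f z * c z - f z * deriv c z = 2 * α) (n : ℕ) :
    let G := hankel (recSeq c f) (n + 1)
    let F := hankel (recSeq c f) n
    hirotaD 2 G F z + (2 * (c z * f z) - 2 * z) * (G z * F z) = 0 ∧
    hirotaD 3 G F z + (6 * (c z * f z) - 2 * z) * hirotaD 1 G F z
      - (4 * (α + n) + 2) * (G z * F z) = 0 := by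
  intro G F
  have key := hankelDet_bilinear (isMomentSeq_momentSeq jetDer (X 3) (X 1)) (momentSeq_zero ..)
    (x := X 0) (A := jetAlpha) (by simp [jetDer_X]) jetDer_jetAlpha jetAlpha_add_natCast_ne_zero
    (by simp [jetDer_X]) (by simpa [jetDer_X] using jetAlpha_spec) n
  have hα : jetEval c f z jetAlpha = α := by
    simp only [jetEval, jetAlpha, map_mul, map_sub, eval_C, eval_X, cons_val]
    linear_combination hW / 2
  obtain ⟨h1, h2, h3⟩ := hirotaD_formulas hV (G := G) (F := F)
    (g := fun k s => jetEval c f s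
      (jetDer^[k] (hankelDet (momentSeq jetDer (X 3) (X 1)) (n + 1))))
    (f := fun k s => jetEval c f s (jetDer^[k] (hankelDet (momentSeq jetDer (X 3) (X 1)) n)))
    (fun s hs => h.hankel_eq hV _ hs) (fun s hs => h.hankel_eq hV _ hs)
    (fun k s hs => by
      rw [Function.iterate_succ_apply']
      exact h.hasDerivAt_jetEval hs _)
    (fun k s hs => by
      rw [Function.iterate_succ_apply']
      exact h.hasDerivAt_jetEval hs _) hz
  have hG : G z = _ := h.hankel_eq hV (n + 1) hz
  have hF : F z = _ := h.hankel_eq hV n hz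
  have hX0 : jetEval c f z (X 0) = z := by simp [jetEval]
  have hX1 : jetEval c f z (X 1) = f z := by simp [jetEval]
  have hX3 : jetEval c f z (X 3) = c z := by simp [jetEval]
  have e1 := congrArg (jetEval c f z) key.1
  have e2 := congrArg (jetEval c f z) key.2
  simp only [map_add, map_sub, map_mul, map_ofNat, map_natCast, map_zero, hα, hX0, hX1, hX3]
    at e1 e2
  simp only [Function.iterate_succ_apply', Function.iterate_zero_apply] at h1 h2 h3
  rw [h1, h2, h3, hG, hF]
  exact ⟨e1, e2⟩

end Jet

/-! ### Local structure of solutions of P34 -/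

section Solution

variable {α : ℂ} {U : Set ℂ} {w ψ : ℂ → ℂ}

/-- Infinite meromorphic order spreads over a preconnected set. -/
theorem vanishesOn_of_eventually_eq_zero (hU : IsPreconnected U) (hw : MeromorphicOn w U)
    {z : ℂ} (hz : z ∈ U) (h : ∀ᶠ x in 𝓝 z, w x = 0) : VanishesOn U w := by
  intro y hy hwy
  have hzt : meromorphicOrderAt w z = ⊤ :=
    meromorphicOrderAt_eq_top_iff.2 (h.filter_mono nhdsWithin_le_nhds)
  have hyt : meromorphicOrderAt w y = ⊤ := by
    by_contra hne
    exact hw.meromorphicOrderAt_ne_top_of_isPreconnected hU hy hz hne hzt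
  exact (hwy.frequently_zero_iff_eventually_zero.1
    (meromorphicOrderAt_eq_top_iff.1 hyt).frequently).self_of_nhds

/-- Differentiating the first order equation and eliminating w'' by P34 gives 4w² times the claim.
If w is not identically zero, its zeros are isolated and analyticity fills them in. -/
theorem IsLinSolution.satisfiesSecondLin (hUo : IsOpen U) (hUc : IsPreconnected U)
    (hw : IsSolution α U w) (hψ : IsLinSolution α U w ψ)
    (hψ' : VanishesOn U w → SatisfiesSecondLin U w ψ) : SatisfiesSecondLin U w ψ := by
  intro z hz hwz hψz
  rcases hwz.eventually_eq_zero_or_eventually_ne_zero with h0 | h0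
  · exact hψ' (vanishesOn_of_eventually_eq_zero hUc hw.meromorphic hz h0) z hz hwz hψz
  have han : AnalyticAt ℂ (fun x => deriv (deriv ψ) x + (w x - 2 * x) * ψ x) z :=
    hψz.deriv.deriv.add ((hwz.sub (analyticAt_const.mul analyticAt_id)).mul hψz)
  have hlin : ∀ᶠ x in 𝓝 z, 2 * w x * deriv ψ x - deriv w x * ψ x - 4 * α * ψ x = 0 := by
    filter_upwards [hUo.mem_nhds hz, hwz.eventually_analyticAt, hψz.eventually_analyticAt]
      with x hx hwx hψx using hψ.equation x hx hwx hψx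
  have hne : ∀ᶠ x in 𝓝[≠] z, deriv (deriv ψ) x + (w x - 2 * x) * ψ x = 0 := by
    filter_upwards [h0, nhdsWithin_le_nhds hlin.eventually_nhds,
      nhdsWithin_le_nhds (hUo.mem_nhds hz), nhdsWithin_le_nhds hwz.eventually_analyticAt,
      nhdsWithin_le_nhds hψz.eventually_analyticAt] with x hx0 hlinx hxU hwx hψx
    have hd := ((((hwx.differentiableAt.hasDerivAt.const_mul 2).mul
      hψx.deriv.differentiableAt.hasDerivAt).sub (hwx.deriv.differentiableAt.hasDerivAt.mul
      hψx.differentiableAt.hasDerivAt)).sub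
      (hψx.differentiableAt.hasDerivAt.const_mul (4 * α))).unique
      ((hasDerivAt_const x (0 : ℂ)).congr_of_eventuallyEq hlinx)
    have hl := hlinx.self_of_nhds
    have hp := hw.equation x hxU hwx
    refine (mul_eq_zero.1 (?_ : 4 * w x ^ 2 * _ = 0)).resolve_left
      (by simpa using hx0)
    linear_combination 2 * w x * hd + (4 * α - deriv w x) * hl + ψ x * hp
  exact (han.frequently_zero_iff_eventually_zero.1 hne.frequently).self_of_nhds

theorem isPair_of_isSolution (hUo : IsOpen U) (hUc : IsPreconnected U)
    (hw : IsSolution α U w) (hψ : IsLinSolution α U w ψ)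
    (hψ' : VanishesOn U w → SatisfiesSecondLin U w ψ) {V : Set ℂ} (hV : IsOpen V) (hVU : V ⊆ U)
    (hwV : ∀ z ∈ V, AnalyticAt ℂ w z) (hψV : ∀ z ∈ V, AnalyticAt ℂ ψ z)
    (h0 : ∀ z ∈ V, ψ z ≠ 0) :
    IsPair V (phi0 w ψ) ψ ∧
      ∀ z ∈ V, deriv ψ z * phi0 w ψ z - ψ z * deriv (phi0 w ψ) z = 2 * α := by
  have hS := hψ.satisfiesSecondLin hUo hUc hw hψ'
  have hd : ∀ z ∈ V, HasDerivAt (phi0 w ψ)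
      ((deriv ψ z * phi0 w ψ z - 2 * α) / ψ z) z := by
    intro z hz
    have hl := hψ.equation z (hVU hz) (hwV z hz) (hψV z hz)
    have hz0 := h0 z hz
    refine ((hwV z hz).differentiableAt.hasDerivAt.div
      ((hψV z hz).differentiableAt.hasDerivAt.const_mul 2)
      (mul_ne_zero two_ne_zero hz0)).congr_deriv ?_
    rw [phi0]
    field_simp
    linear_combination -hl
  have hw2 : ∀ z ∈ V, w z = 2 * (phi0 w ψ z * ψ z) := by
    intro z hz
    have hz0 := h0 z hz
    rw [phi0]
    field_simp
  have hψ2 : ∀ z ∈ V, HasDerivAt (deriv ψ) ((2 * z - 2 * (phi0 w ψ z * ψ z)) * ψ z) z := by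
    intro z hz
    refine (hψV z hz).deriv.differentiableAt.hasDerivAt.congr_deriv ?_
    have := hS z (hVU hz) (hwV z hz) (hψV z hz)
    rw [hw2 z hz] at this
    linear_combination this
  refine ⟨⟨fun z hz => (hψV z hz).differentiableAt.hasDerivAt, hψ2,
    fun z hz => (hd z hz).differentiableAt.hasDerivAt, fun z hz => ?_⟩, fun z hz => ?_⟩
  · have hz0 := h0 z hz
    -- Solving the Wronskian relation for φ₀' lets φ₀'' be computed without w''.
    have hEq : deriv (phi0 w ψ) =ᶠ[𝓝 z] fun x => (deriv ψ x * phi0 w ψ x - 2 * α) / ψ x := by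
      filter_upwards [hV.mem_nhds hz] with x hx using (hd x hx).deriv
    refine (((((hψ2 z hz).mul (hd z hz)).sub_const _).div
      (hψV z hz).differentiableAt.hasDerivAt hz0).congr_of_eventuallyEq hEq).congr_deriv ?_
    rw [Pi.mul_apply]
    field_simp
    ring
  · have hz0 := h0 z hz
    rw [(hd z hz).deriv]
    field_simp
    ring

end Solution

end PXXXIV

theorem proposition1 (α : ℂ) (U : Set ℂ) (hUo : IsOpen U) (hUc : IsPreconnected U)
    (w ψ₀ : ℂ → ℂ)
    (hw : PXXXIV.IsSolution α U w)
    (hψ : PXXXIV.IsLinSolution α U w ψ₀)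
    (hψ' : PXXXIV.VanishesOn U w → PXXXIV.SatisfiesSecondLin U w ψ₀)
    (N : ℤ) (z : ℂ) (hz : z ∈ U)
    (hwz : AnalyticAt ℂ w z) (hψz : AnalyticAt ℂ ψ₀ z) (hψ0 : ψ₀ z ≠ 0) :
    PXXXIV.hirotaD 2 (PXXXIV.tau w ψ₀ (N + 1)) (PXXXIV.tau w ψ₀ N) z
        + (w z - 2 * z) * (PXXXIV.tau w ψ₀ (N + 1) z * PXXXIV.tau w ψ₀ N z) = 0 ∧
    PXXXIV.hirotaD 3 (PXXXIV.tau w ψ₀ (N + 1)) (PXXXIV.tau w ψ₀ N) z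
        + (3 * w z - 2 * z)
          * PXXXIV.hirotaD 1 (PXXXIV.tau w ψ₀ (N + 1)) (PXXXIV.tau w ψ₀ N) z
        - 4 * (α + (N : ℂ) + 1 / 2)
          * (PXXXIV.tau w ψ₀ (N + 1) z * PXXXIV.tau w ψ₀ N z) = 0 := by
  open Topology in
  have hev : ∀ᶠ x in 𝓝 z, x ∈ U ∧ AnalyticAt ℂ w x ∧ AnalyticAt ℂ ψ₀ x ∧ ψ₀ x ≠ 0 :=
    Filter.Eventually.and (hUo.mem_nhds hz) (hwz.eventually_analyticAt.and
      (hψz.eventually_analyticAt.and (hψz.continuousAt.eventually_ne hψ0)))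
  obtain ⟨V, hVs, hV, hzV⟩ := eventually_nhds_iff.1 hev
  obtain ⟨hP, hW⟩ := PXXXIV.isPair_of_isSolution hUo hUc hw hψ hψ' hV (fun x hx => (hVs x hx).1)
    (fun x hx => (hVs x hx).2.1) (fun x hx => (hVs x hx).2.2.1) (fun x hx => (hVs x hx).2.2.2)
  have hw2 : w z = 2 * (PXXXIV.phi0 w ψ₀ z * ψ₀ z) := by
    rw [PXXXIV.phi0]
    field_simp
  have hpos : ∀ n : ℕ, PXXXIV.tau w ψ₀ n =
      PXXXIV.hankel (PXXXIV.recSeq (PXXXIV.phi0 w ψ₀) ψ₀) n := by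
    rintro (_ | n)
    · funext x
      simp [PXXXIV.tau, PXXXIV.hankel]
    · rw [PXXXIV.tau, if_pos (by positivity), Int.toNat_natCast, PXXXIV.psi]
  have hneg : ∀ n : ℕ, PXXXIV.tau w ψ₀ (-n) =
      PXXXIV.hankel (PXXXIV.recSeq ψ₀ (PXXXIV.phi0 w ψ₀)) n := by
    rintro (_ | n)
    · funext x
      simp [PXXXIV.tau, PXXXIV.hankel]
    · rw [PXXXIV.tau, if_neg (by omega), if_neg (by omega), neg_neg, Int.toNat_natCast, PXXXIV.phi]
  obtain ⟨n, rfl | rfl⟩ : ∃ n : ℕ, N = n ∨ N = -(n + 1 : ℕ) := by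
    rcases N with n | n
    · exact ⟨n, Or.inl rfl⟩
    · exact ⟨n, Or.inr rfl⟩
  · rw [show (n : ℤ) + 1 = (n + 1 : ℕ) by push_cast; rfl, hpos, hpos]
    obtain ⟨h1, h2⟩ := hP.hankel_bilinear hV hzV (hW z hzV) n
    rw [hw2]
    push_cast
    exact ⟨by linear_combination h1, by linear_combination h2⟩
  · rw [show -((n + 1 : ℕ) : ℤ) + 1 = -(n : ℤ) by push_cast; ring, hneg, hneg]
    -- Here N = -(n + 1), so the larger determinant is τ_N, in the second slot. Swapping slots flips
    -- the odd Hirota derivatives, and -α + n + 1/2 = -(α + N + 1/2) matches that sign.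
    obtain ⟨h1, h2⟩ := hP.symm.hankel_bilinear (α := -α) hV hzV
      (by linear_combination -hW z hzV) n
    rw [PXXXIV.hirotaD_comm 1 (PXXXIV.hankel _ (n + 1)),
      PXXXIV.hirotaD_comm 2 (PXXXIV.hankel _ (n + 1)),
      PXXXIV.hirotaD_comm 3 (PXXXIV.hankel _ (n + 1)), hw2]
    push_cast
    exact ⟨by linear_combination h1, by linear_combination -h2⟩
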